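/- Let $X$ be a smooth projective variety of dimension $n$ over $\mathbb{C}$ (a connected compact complex manifold that embeds in a projective space) with nonnegative Kodaira dimension, i.e. $H^0(X,mK_X)\neq 0$ for some $m\ge 1$. For a section $\sigma$ of $mK_X$, written locally as $\sigma=f\,(dz_1\wedge\dots\wedge dz_n)^{\otimes m}$, the form $|\sigma|^{2/m}=|(\sigma\wedge\bar\sigma)^{1/m}|$ is the nonnegative $(n,n)$-form $|f|^{2/m}\,|dz_1\wedge\dots\wedge dz_n\wedge d\bar z_1\wedge\dots\wedge d\bar z_n|$; similarly, for a line bundle $A$ with a hermitian metric $h_A$ and a section $\sigma$ of $A+mK_X$, $h_A^{1/m}|\sigma|^{2/m}=|h_A^{1/m}(\sigma\wedge\bar\sigma)^{1/m}|$ is a nonnegative $(n,n)$-form. The inverse of a nonnegative $(n,n)$-form is a metric on $K_X$ with values in $[0,+\infty]$, and the lower envelope of a metric is its lower semicontinuous envelope. Put $$K_m(x)=\sup\Big\{|\sigma|^{2/m}(x)\;:\;\sigma\in H^0(X,mK_X),\ \Big|\int_X(\sigma\wedge\bar\sigma)^{1/m}\Big|=1\Big\},$$ and let the canonical AZD $h_{can}$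 be the lower envelope of $\big(\limsup_{m\to\infty}K_m\big)^{-1}$ (here $\sup\emptyset=0$). For an ample line bundle $A$ on $X$ with a $C^\infty$ hermitian metric $h_A$ of strictly positive curvature, put $$\hat K_m^A(x)=\sup\Big\{|\sigma|^{2/m}(x)\;:\;\sigma\in H^0(X,A+mK_X),\ \Big|\int_X h_A^{1/m}(\sigma\wedge\bar\sigma)^{1/m}\Big|=1\Big\},$$ and let $\hat h_{can,A}$ be the lower envelope of $\big(\limsup_{m\to\infty}h_A^{1/m}\hat K_m^A\big)^{-1}$. Let the supercanonical AZD $\hat h_{can}$ be the lower envelope of the pointwise infimum $\inf_A\hat h_{can,A}$ over all ample line bundles $A$ (with metrics $h_A$ as above). Call $A$ sufficiently ample if it is ample and, for all line bundles $L$ with a singular hermitian metric $h_L$ of semipositive curvature current (i.e. with plurisubharmonic local weights, not identically $-\infty$), with multiplier ideal sheaf $\mathcal{I}(h_L)$: the sheaves $\mathcal{O}_X(A+L)\otimes\mathcal{I}(h_L)$ and $\mathcal{O}_X(K_X+A+L)\otimes\mathcal{I}(h_L)$ are globally generated; and, for a fixed $C^\infty$ volume form $dV$ and a constant $C$ independent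 of $(L,h_L)$, of $x\in X$ and of $v$, every $v\in(A+L)_x$ with $(h_Ah_L)(v,v)<\infty$ is the value at $x$ of some $\sigma\in H^0(X,\mathcal{O}_X(A+L)\otimes\mathcal{I}(h_L))$ with $\int_X|\sigma|^2h_Ah_L\,dV\le C\,(h_Ah_L)(v,v)$. Then for every sufficiently ample $A$ and every $h_A$ as above $$\hat h_{can,A}\le h_{can}$$ holds pointwise on $X$. In particular, $$\hat h_{can}\le h_{can}$$ holds pointwise on $X$. -/

import Mathlib

open scoped Manifold ContDiff ENNReal Topology
open MeasureTheory Filter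

noncomputable section

universe u

namespace CanonicalAZD

/-! ### Holomorphic line bundles

Throughout, `X` is a complex manifold of dimension `n`, modelled on `Fin n → ℂ`. -/

/-- A holomorphic line bundle on `X`, given by a trivializing open cover `dom i` and a holomorphic
cocycle. If `e i` is the frame over `dom i`, then `e j = trans i j • e i`, so a section
`f i • e i = f j • e j` satisfies `f i = trans i j * f j`. -/
structure HolLineBundle (n : ℕ) (X : Type u) [TopologicalSpace X]
    [ChartedSpace (Fin n → ℂ) X] where
  /-- the index set of the trivializing cover -/
  ι : Type u
  /-- the trivializing open sets -/
  dom : ι → Set X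
  isOpen_dom : ∀ i, IsOpen (dom i)
  /-- an index of a trivializing open set that contains the given point -/
  indexAt : X → ι
  mem_indexAt : ∀ x, x ∈ dom (indexAt x)
  /-- the transition functions -/
  trans : ι → ι → X → ℂ
  holo_trans : ∀ i j,
    ContMDiffOn 𝓘(ℂ, Fin n → ℂ) 𝓘(ℂ, ℂ) ω (trans i j) (dom i ∩ dom j)
  trans_self : ∀ i x, x ∈ dom i → trans i i x = 1
  trans_mul : ∀ i j k x, x ∈ dom i → x ∈ dom j → x ∈ dom k →
    trans i j x * trans j k x = trans i k x

namespace HolLineBundle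

variable {n : ℕ} {X : Type u} [TopologicalSpace X] [ChartedSpace (Fin n → ℂ) X]

/-- The tensor product of two line bundles (`A + B` in additive notation). -/
def tensor (A B : HolLineBundle n X) : HolLineBundle n X where
  ι := A.ι × B.ι
  dom i := A.dom i.1 ∩ B.dom i.2
  isOpen_dom i := (A.isOpen_dom i.1).inter (B.isOpen_dom i.2)
  indexAt x := (A.indexAt x, B.indexAt x)
  mem_indexAt x := ⟨A.mem_indexAt x, B.mem_indexAt x⟩
  trans i j x := A.trans i.1 j.1 x * B.trans i.2 j.2 x
  holo_trans i j :=
    ((A.holo_trans i.1 j.1).mono fun _ hx => ⟨hx.1.1, hx.2.1⟩).mul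
      ((B.holo_trans i.2 j.2).mono fun _ hx => ⟨hx.1.2, hx.2.2⟩)
  trans_self i x hx := by rw [A.trans_self _ _ hx.1, B.trans_self _ _ hx.2, one_mul]
  trans_mul i j k x hi hj hk := by
    rw [← A.trans_mul i.1 j.1 k.1 x hi.1 hj.1 hk.1, ← B.trans_mul i.2 j.2 k.2 x hi.2 hj.2 hk.2]
    ring

/-- The tensor power of a line bundle (`m A` in additive notation). -/
def pow (A : HolLineBundle n X) (m : ℕ) : HolLineBundle n X where
  ι := A.ι
  dom := A.dom
  isOpen_dom := A.isOpen_dom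
  indexAt := A.indexAt
  mem_indexAt := A.mem_indexAt
  trans i j x := A.trans i j x ^ m
  holo_trans i j := (A.holo_trans i j).pow m
  trans_self i x hx := by rw [A.trans_self i x hx, one_pow]
  trans_mul i j k x hi hj hk := by rw [← mul_pow, A.trans_mul i j k x hi hj hk]

/-- A global holomorphic section, given by its coefficients in the frames. -/
structure HolSection (L : HolLineBundle n X) where
  /-- the coefficient of the section in the frame over `L.dom i` -/
  val : L.ι → X → ℂ
  holo : ∀ i, ContMDiffOn 𝓘(ℂ, Fin n → ℂ) 𝓘(ℂ, ℂ) ω (val i) (L.dom i)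
  compat : ∀ i j x, x ∈ L.dom i → x ∈ L.dom j → val i x = L.trans i j x * val j x

/-- `L` is very ample: finitely many global sections without common zeros define an injective
immersion `x ↦ [s 0 x : ⋯ : s N x]` of `X` into projective space (which is an embedding when `X`
is compact). -/
def IsVeryAmple (L : HolLineBundle n X) : Prop :=
  ∃ (N : ℕ) (s : Fin (N + 1) → L.HolSection),
    (∀ i x, x ∈ L.dom i → ∃ k, (s k).val i x ≠ 0) ∧
    (∀ i x j y, x ∈ L.dom i → y ∈ L.dom j →
      (∃ c : ℂ, ∀ k, (s k).val i x = c * (s k).val j y) → x = y) ∧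
    (∀ i x, x ∈ L.dom i → ∀ e ∈ atlas (Fin n → ℂ) X, x ∈ e.source → ∀ v : Fin n → ℂ,
      (∃ c : ℂ, ∀ k, fderiv ℂ ((s k).val i ∘ e.symm) (e x) v = c * (s k).val i x) → v = 0)

/-- `L` is ample: some positive tensor power of it is very ample. -/
def IsAmple (L : HolLineBundle n X) : Prop :=
  ∃ k : ℕ, 1 ≤ k ∧ (L.pow k).IsVeryAmple

/-- A `C^∞` hermitian metric on `L`, given by the squared lengths of the frames. -/
structure SmoothMetric (L : HolLineBundle n X) where
  /-- the squared length of the frame over `L.dom i` -/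
  val : L.ι → X → ℝ
  pos : ∀ i x, x ∈ L.dom i → 0 < val i x
  smooth : ∀ i, ContMDiffOn 𝓘(ℝ, Fin n → ℂ) 𝓘(ℝ, ℝ) ∞ (val i) (L.dom i)
  compat : ∀ i j x, x ∈ L.dom i → x ∈ L.dom j →
    val j x = ‖L.trans i j x‖ ^ 2 * val i x

/-- The curvature `-∂∂̄ log h` is strictly positive: in each chart the Levi form of the local
weight `φ = -log h` is positive definite; here `D²φ(v, v) + D²φ(iv, iv)` is four times the Levi
form `∑ φ_{j k̄} v_j v̄_k`. -/
def SmoothMetric.HasPositiveCurvature {L : HolLineBundle n X} (h : L.SmoothMetric) : Prop :=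
  ∀ i, ∀ e ∈ atlas (Fin n → ℂ) X, ∀ x, x ∈ L.dom i → x ∈ e.source → ∀ v : Fin n → ℂ, v ≠ 0 →
    0 < iteratedFDeriv ℝ 2 (fun z => -Real.log (h.val i (e.symm z))) (e x) ![v, v] +
      iteratedFDeriv ℝ 2 (fun z => -Real.log (h.val i (e.symm z))) (e x)
        ![Complex.I • v, Complex.I • v]

end HolLineBundle

/-! ### Plurisubharmonic functions and pseudoeffective singular hermitian line bundles -/

/-- Plurisubharmonic functions on an open set `U` of `ℂⁿ`, with values in `[-∞, ∞)`: upper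
semicontinuous, with the sub-mean value inequality on each closed complex disc in `U`. As `φ` may
take the value `-∞`, the inequality is written as `mean (C - φ) ≤ C - φ z`, where `C` is an upper
bound of `φ` on the boundary circle. The function `-∞` is allowed. -/
def IsPshOn {n : ℕ} (φ : (Fin n → ℂ) → EReal) (U : Set (Fin n → ℂ)) : Prop :=
  UpperSemicontinuousOn φ U ∧ (∀ z ∈ U, φ z ≠ ⊤) ∧
    ∀ z v : Fin n → ℂ, (∀ t : ℂ, ‖t‖ ≤ 1 → z + t • v ∈ U) →
      ∀ C : ℝ, (∀ θ : ℝ, φ (z + circleMap 0 1 θ • v) ≤ (C : EReal)) →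
        (((∫⁻ θ in Set.Ioc 0 (2 * Real.pi),
            ((C : EReal) - φ (z + circleMap 0 1 θ • v)).toENNReal) /
              ENNReal.ofReal (2 * Real.pi) : ℝ≥0∞) : EReal) ≤ (C : EReal) - φ z

namespace HolLineBundle

variable {n : ℕ} {X : Type u} [TopologicalSpace X] [ChartedSpace (Fin n → ℂ) X]

/-- A singular hermitian metric with semipositive curvature current on `L`: its local weights
`-log h` are plurisubharmonic, and it is not identically `+∞` (for connected `X` its local weights
are then locally integrable). A pair of `L` and such a metric is a pseudoeffective singular
hermitian line bundle. -/
structure PsefMetric (L : HolLineBundle n X) where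
  /-- the squared length of the frame over `L.dom i` -/
  val : L.ι → X → ℝ≥0∞
  compat : ∀ i j x, x ∈ L.dom i → x ∈ L.dom j →
    val j x = ‖L.trans i j x‖ₑ ^ 2 * val i x
  psh : ∀ i, ∀ e ∈ atlas (Fin n → ℂ) X,
    IsPshOn (fun z => -ENNReal.log (val i (e.symm z))) (e.target ∩ e.symm ⁻¹' L.dom i)
  nontrivial : ∃ i, ∃ x ∈ L.dom i, val i x ≠ ⊤

/-- The germ of `f` at `x` lies in the stalk at `x` of the multiplier ideal sheaf of `h`: `f` is
holomorphic and `|f|² h` is integrable near `x`. -/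
def PsefMetric.MemMultiplierIdeal {L : HolLineBundle n X} (h : L.PsefMetric) (x : X)
    (f : X → ℂ) : Prop :=
  ∃ V : Set X, IsOpen V ∧ x ∈ V ∧ V ⊆ L.dom (L.indexAt x) ∧
    V ⊆ (chartAt (Fin n → ℂ) x).source ∧
    ContMDiffOn 𝓘(ℂ, Fin n → ℂ) 𝓘(ℂ, ℂ) ω f V ∧
    ∫⁻ z in (chartAt (Fin n → ℂ) x).target ∩ (chartAt (Fin n → ℂ) x).symm ⁻¹' V,
      ‖f ((chartAt (Fin n → ℂ) x).symm z)‖ₑ ^ 2 *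
        h.val (L.indexAt x) ((chartAt (Fin n → ℂ) x).symm z) < ⊤

/-- `σ` is a global section of `O(M + L) ⊗ I(h)`. -/
def PsefMetric.IsMultiplierSection {L : HolLineBundle n X} (h : L.PsefMetric)
    {M : HolLineBundle n X} (σ : (M.tensor L).HolSection) : Prop :=
  ∀ x, h.MemMultiplierIdeal x (σ.val (M.indexAt x, L.indexAt x))

/-- The sheaf `O(M + L) ⊗ I(h)` is globally generated: at each point `x` every germ of it is a
combination of germs of global sections with coefficients in the local ring of holomorphic germs
at `x`. -/
def PsefMetric.GloballyGenerated {L : HolLineBundle n X} (h : L.PsefMetric)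
    (M : HolLineBundle n X) : Prop :=
  ∀ (x : X) (f : X → ℂ), h.MemMultiplierIdeal x f →
    ∃ (k : ℕ) (s : Fin k → (M.tensor L).HolSection) (g : Fin k → X → ℂ),
      (∀ j, h.IsMultiplierSection (s j)) ∧
      (∀ j, ContMDiffAt 𝓘(ℂ, Fin n → ℂ) 𝓘(ℂ, ℂ) ω (g j) x) ∧
      ∀ᶠ y in 𝓝 x, f y = ∑ j, g j y * (s j).val (M.indexAt x, L.indexAt x) y

end HolLineBundle

/-! ### The canonical bundle and integration -/

section Canonical

variable {n : ℕ} {X : Type u} [TopologicalSpace X]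

/-- The complex Jacobian determinant `det (∂z'_i / ∂z_j)` at `x` of the change of coordinates from
the chart `e = (z_1, …, z_n)` to the chart `e' = (z'_1, …, z'_n)`. -/
def jacobian (e e' : OpenPartialHomeomorph X (Fin n → ℂ)) (x : X) : ℂ :=
  Matrix.det (Matrix.of fun i j => fderiv ℂ (e' ∘ e.symm) (e x) (Pi.single j 1) i)

theorem contDiffAt_transition [ChartedSpace (Fin n → ℂ) X]
    [IsManifold 𝓘(ℂ, Fin n → ℂ) ω X]
    {e e' : OpenPartialHomeomorph X (Fin n → ℂ)}
    (he : e ∈ atlas (Fin n → ℂ) X) (he' : e' ∈ atlas (Fin n → ℂ) X) {x : X}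
    (hx : x ∈ e.source) (hx' : x ∈ e'.source) :
    ContDiffAt ℂ ω (e' ∘ e.symm) (e x) := by
  have h1 : ContMDiffAt 𝓘(ℂ, Fin n → ℂ) 𝓘(ℂ, Fin n → ℂ) ω e.symm (e x) :=
    contMDiffAt_symm_of_mem_maximalAtlas (IsManifold.subset_maximalAtlas he) (e.map_source hx)
  have h2 : ContMDiffAt 𝓘(ℂ, Fin n → ℂ) 𝓘(ℂ, Fin n → ℂ) ω e' (e.symm (e x)) :=
    contMDiffAt_of_mem_maximalAtlas (IsManifold.subset_maximalAtlas he')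
      (by rwa [e.left_inv hx])
  exact (h2.comp (e x) h1).contDiffAt

theorem contMDiffOn_jacobian [ChartedSpace (Fin n → ℂ) X]
    [IsManifold 𝓘(ℂ, Fin n → ℂ) ω X]
    {e e' : OpenPartialHomeomorph X (Fin n → ℂ)}
    (he : e ∈ atlas (Fin n → ℂ) X) (he' : e' ∈ atlas (Fin n → ℂ) X) :
    ContMDiffOn 𝓘(ℂ, Fin n → ℂ) 𝓘(ℂ, ℂ) ω (jacobian e e') (e.source ∩ e'.source) := by
  rintro x ⟨hx, hx'⟩
  have hd : ContDiffAt ℂ ω (fderiv ℂ (e' ∘ e.symm)) (e x) :=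
    (contDiffAt_transition he he' hx hx').fderiv_right le_rfl
  have hdet : ContDiffAt ℂ ω (fun z : Fin n → ℂ => Matrix.det
      (Matrix.of fun i j => fderiv ℂ (e' ∘ e.symm) z (Pi.single j 1) i)) (e x) := by
    simp only [Matrix.det_apply']
    refine ContDiffAt.sum fun p _ => contDiffAt_const.mul (contDiffAt_prod fun i _ => ?_)
    exact contDiffAt_pi.1 (hd.clm_apply contDiffAt_const) (p i)
  have hchart : ContMDiffAt 𝓘(ℂ, Fin n → ℂ) 𝓘(ℂ, Fin n → ℂ) ω e x :=
    contMDiffAt_of_mem_maximalAtlas (IsManifold.subset_maximalAtlas he) hx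
  exact (hdet.contMDiffAt.comp x hchart).contMDiffWithinAt

theorem jacobian_self (e : OpenPartialHomeomorph X (Fin n → ℂ)) {x : X} (hx : x ∈ e.source) :
    jacobian e e x = 1 := by
  have h : (e ∘ e.symm) =ᶠ[𝓝 (e x)] id := by
    filter_upwards [e.open_target.mem_nhds (e.map_source hx)] with z hz
    exact e.right_inv hz
  have h2 : (Matrix.of fun i j => fderiv ℂ (e ∘ e.symm) (e x) (Pi.single j 1) i) =
      (1 : Matrix (Fin n) (Fin n) ℂ) := by
    ext i j
    simp [h.fderiv_eq, Matrix.one_apply, Pi.single_apply]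
  rw [jacobian, h2, Matrix.det_one]

theorem jacobian_mul [ChartedSpace (Fin n → ℂ) X]
    [IsManifold 𝓘(ℂ, Fin n → ℂ) ω X]
    {e₁ e₂ e₃ : OpenPartialHomeomorph X (Fin n → ℂ)}
    (h₁ : e₁ ∈ atlas (Fin n → ℂ) X) (h₂ : e₂ ∈ atlas (Fin n → ℂ) X)
    (h₃ : e₃ ∈ atlas (Fin n → ℂ) X) {x : X}
    (hx₁ : x ∈ e₁.source) (hx₂ : x ∈ e₂.source) (hx₃ : x ∈ e₃.source) :
    jacobian e₁ e₂ x * jacobian e₂ e₃ x = jacobian e₁ e₃ x := by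
  have hev : (e₃ ∘ e₁.symm) =ᶠ[𝓝 (e₁ x)] (e₃ ∘ e₂.symm) ∘ (e₂ ∘ e₁.symm) := by
    have hc : ContinuousAt e₁.symm (e₁ x) := e₁.continuousAt_symm (e₁.map_source hx₁)
    have hm : e₂.source ∈ 𝓝 (e₁.symm (e₁ x)) := by
      rw [e₁.left_inv hx₁]; exact e₂.open_source.mem_nhds hx₂
    filter_upwards [hc hm] with z hz
    simp only [Function.comp_apply]
    rw [e₂.left_inv hz]
  have hpt : (e₂ ∘ e₁.symm) (e₁ x) = e₂ x := by
    simp only [Function.comp_apply]; rw [e₁.left_inv hx₁]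
  have d12 : DifferentiableAt ℂ (e₂ ∘ e₁.symm) (e₁ x) :=
    (contDiffAt_transition h₁ h₂ hx₁ hx₂).differentiableAt (by simp)
  have d23 : DifferentiableAt ℂ (e₃ ∘ e₂.symm) ((e₂ ∘ e₁.symm) (e₁ x)) := by
    rw [hpt]; exact (contDiffAt_transition h₂ h₃ hx₂ hx₃).differentiableAt (by simp)
  have key : fderiv ℂ (e₃ ∘ e₁.symm) (e₁ x) =
      (fderiv ℂ (e₃ ∘ e₂.symm) (e₂ x)).comp (fderiv ℂ (e₂ ∘ e₁.symm) (e₁ x)) := by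
    rw [hev.fderiv_eq, fderiv_comp _ d23 d12, hpt]
  have hmat : ∀ f : (Fin n → ℂ) →L[ℂ] (Fin n → ℂ),
      (Matrix.of fun i j => f (Pi.single j 1) i) =
        LinearMap.toMatrix' (f : (Fin n → ℂ) →ₗ[ℂ] (Fin n → ℂ)) := by
    intro f
    ext i j
    simp [LinearMap.toMatrix'_apply]
  simp only [jacobian, hmat]
  rw [key, ContinuousLinearMap.toLinearMap_comp, LinearMap.toMatrix'_comp, Matrix.det_mul, mul_comm]

end Canonical

/-- The canonical bundle `K_X`, trivialized over each chart `e = (z_1, …, z_n)` of the atlas by the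
frame `dz_1 ∧ ⋯ ∧ dz_n`. A section of `m K_X` is thus locally `f_e (dz_1 ∧ ⋯ ∧ dz_n)^m`. -/
def canonicalBundle (n : ℕ) (X : Type u) [TopologicalSpace X] [ChartedSpace (Fin n → ℂ) X]
    [IsManifold 𝓘(ℂ, Fin n → ℂ) ω X] : HolLineBundle n X where
  ι := atlas (Fin n → ℂ) X
  dom e := e.1.source
  isOpen_dom e := e.1.open_source
  indexAt x := ⟨chartAt (Fin n → ℂ) x, chart_mem_atlas _ x⟩
  mem_indexAt x := mem_chart_source _ x
  trans e e' := jacobian e.1 e'.1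
  holo_trans e e' := contMDiffOn_jacobian e.2 e'.2
  trans_self e _ hx := jacobian_self e.1 hx
  trans_mul e₁ e₂ e₃ _ h₁ h₂ h₃ := jacobian_mul e₁.2 e₂.2 e₃.2 h₁ h₂ h₃

section Metrics

variable {n : ℕ} {X : Type u} [TopologicalSpace X] [ChartedSpace (Fin n → ℂ) X]

/-- The measure `|dz_1 ∧ ⋯ ∧ dz_n ∧ dz̄_1 ∧ ⋯ ∧ dz̄_n|`, which is `2ⁿ` times Lebesgue measure, of
the chart `e`, as a measure on `X`. -/
def chartVolume [MeasurableSpace X] (e : OpenPartialHomeomorph X (Fin n → ℂ)) : Measure X :=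
  ((2 : ℝ≥0∞) ^ n • (volume : Measure (Fin n → ℂ)).restrict e.target).map e.symm

/-- The integral over `X` of the nonnegative `(n, n)`-form which is `ρ e |dz ∧ dz̄|` in the chart
`e`. The measures `ρ e |dz ∧ dz̄|` of the charts agree on overlaps, so the measure on `X` that they
define together is their supremum in the lattice of measures. -/
def integralForm [MeasurableSpace X] (ρ : atlas (Fin n → ℂ) X → X → ℝ≥0∞) : ℝ≥0∞ :=
  (⨆ e : atlas (Fin n → ℂ) X, (chartVolume e.1).withDensity (ρ e)) Set.univ

/-- The lower (semicontinuous) envelope of the local coefficients of a metric. -/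
def lowerEnvelope (h : atlas (Fin n → ℂ) X → X → ℝ≥0∞) : atlas (Fin n → ℂ) X → X → ℝ≥0∞ :=
  fun e x => liminf (h e) (𝓝 x)

/-- Pointwise inequality of two metrics on `K_X`, given by the squared lengths `h e` of the frames
`dz_1 ∧ ⋯ ∧ dz_n` of the charts `e`, with values in `[0, ∞]`. -/
def MetricLE (h h' : atlas (Fin n → ℂ) X → X → ℝ≥0∞) : Prop :=
  ∀ (e : atlas (Fin n → ℂ) X) (x : X), x ∈ e.1.source → h e x ≤ h' e x

variable [IsManifold 𝓘(ℂ, Fin n → ℂ) ω X]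

/-- The line bundle `A + m K_X`. -/
abbrev twist (A : HolLineBundle n X) (m : ℕ) : HolLineBundle n X :=
  A.tensor ((canonicalBundle n X).pow m)

/-- The coefficient of `|σ|^(2/m) = (σ ∧ σ̄)^(1/m)` with respect to `|dz ∧ dz̄|` in the chart `e`,
for a section `σ` of `m K_X`. -/
def pluriDensity (m : ℕ) (σ : ((canonicalBundle n X).pow m).HolSection)
    (e : atlas (Fin n → ℂ) X) (x : X) : ℝ≥0∞ :=
  ‖σ.val e x‖ₑ ^ (2 / (m : ℝ))

/-- The coefficient of `h_A^(1/m) |σ|^(2/m) = h_A^(1/m) (σ ∧ σ̄)^(1/m)` with respect to `|dz ∧ dz̄|`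
in the chart `e`, for a section `σ` of `A + m K_X`. It does not depend on the frame of `A`. -/
def twistedDensity (A : HolLineBundle n X) (hA : A.SmoothMetric) (m : ℕ)
    (σ : (twist A m).HolSection) (e : atlas (Fin n → ℂ) X) (x : X) : ℝ≥0∞ :=
  ENNReal.ofReal (hA.val (A.indexAt x) x) ^ (1 / (m : ℝ)) *
    ‖σ.val (A.indexAt x, e) x‖ₑ ^ (2 / (m : ℝ))

/-- `h_A |σ|² h_L dV` for a section `σ` of `A + L`, as a density; the `C^∞` volume form `dV` is
given as the inverse of a `C^∞` hermitian metric `w` on `K_X`. -/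
def l2Density {A L : HolLineBundle n X} (hA : A.SmoothMetric) (hL : L.PsefMetric)
    (w : (canonicalBundle n X).SmoothMetric) (σ : (A.tensor L).HolSection)
    (e : atlas (Fin n → ℂ) X) (x : X) : ℝ≥0∞ :=
  ‖σ.val (A.indexAt x, L.indexAt x) x‖ₑ ^ 2 * ENNReal.ofReal (hA.val (A.indexAt x) x) *
    hL.val (L.indexAt x) x * (ENNReal.ofReal (w.val e x))⁻¹

variable [MeasurableSpace X]

/-- `L²` interpolation at points: there are a `C^∞` volume form `dV` and a constant `C` such that
for all pseudoeffective `(L, h_L)` and all points `x`, each vector `v` of the fibre of `A + L` at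
`x` with finite length is the value at `x` of a section of `O(A + L) ⊗ I(h_L)` whose squared `L²`
norm is at most `C` times the squared length of `v`. (As the fibre is one-dimensional, this is the
existence of bounded linear interpolation operators with uniformly bounded norms.) -/
def HasInterpolation (A : HolLineBundle n X) (hA : A.SmoothMetric) : Prop :=
  ∃ (w : (canonicalBundle n X).SmoothMetric) (C : NNReal),
    ∀ (L : HolLineBundle n X) (hL : L.PsefMetric) (x : X) (v : ℂ),
      ‖v‖ₑ ^ 2 * ENNReal.ofReal (hA.val (A.indexAt x) x) * hL.val (L.indexAt x) x ≠ ⊤ →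
      ∃ σ : (A.tensor L).HolSection, hL.IsMultiplierSection σ ∧
        σ.val (A.indexAt x, L.indexAt x) x = v ∧
        integralForm (l2Density hA hL w σ) ≤
          C * (‖v‖ₑ ^ 2 * ENNReal.ofReal (hA.val (A.indexAt x) x) * hL.val (L.indexAt x) x)

/-- `A` is sufficiently ample (with `h_A` the metric on it used in the `L²` norms). -/
def IsSufficientlyAmple (A : HolLineBundle n X) (hA : A.SmoothMetric) : Prop :=
  A.IsAmple ∧
  (∀ (L : HolLineBundle n X) (hL : L.PsefMetric),
    hL.GloballyGenerated A ∧ hL.GloballyGenerated ((canonicalBundle n X).tensor A)) ∧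
  HasInterpolation A hA

/-- The extremal form `K_m`: the supremum of `|σ|^(2/m)` over the sections `σ` of `m K_X` with
`|∫ (σ ∧ σ̄)^(1/m)| = 1`; it is `0` if there are none. -/
def extremal (m : ℕ) (e : atlas (Fin n → ℂ) X) (x : X) : ℝ≥0∞ :=
  ⨆ (σ : ((canonicalBundle n X).pow m).HolSection) (_ : integralForm (pluriDensity m σ) = 1),
    pluriDensity m σ e x

/-- The canonical AZD `h_can`: the lower envelope of the inverse of `limsup K_m`. -/
def hCan : atlas (Fin n → ℂ) X → X → ℝ≥0∞ :=
  lowerEnvelope fun e x => (limsup (fun m : ℕ => extremal m e x) atTop)⁻¹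

/-- The form `h_A^(1/m) K̂_m^A`, where `K̂_m^A` is the supremum of `|σ|^(2/m)` over the sections `σ`
of `A + m K_X` with `|∫ h_A^(1/m) (σ ∧ σ̄)^(1/m)| = 1`. -/
def extremalTwisted (A : HolLineBundle n X) (hA : A.SmoothMetric) (m : ℕ)
    (e : atlas (Fin n → ℂ) X) (x : X) : ℝ≥0∞ :=
  ⨆ (σ : (twist A m).HolSection) (_ : integralForm (twistedDensity A hA m σ) = 1),
    twistedDensity A hA m σ e x

/-- The metric `ĥ_{can,A}`: the lower envelope of the inverse of `limsup h_A^(1/m) K̂_m^A`. -/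
def hHatCanOf (A : HolLineBundle n X) (hA : A.SmoothMetric) :
    atlas (Fin n → ℂ) X → X → ℝ≥0∞ :=
  lowerEnvelope fun e x => (limsup (fun m : ℕ => extremalTwisted A hA m e x) atTop)⁻¹

/-- The supercanonical AZD `ĥ_can`: the lower envelope of the pointwise infimum of `ĥ_{can,A}` over
all ample line bundles `A` with `C^∞` metrics of strictly positive curvature. -/
def hHatCan : atlas (Fin n → ℂ) X → X → ℝ≥0∞ :=
  lowerEnvelope fun e x =>
    ⨅ (A : HolLineBundle n X) (_ : A.IsAmple) (hA : A.SmoothMetric) (_ : hA.HasPositiveCurvature),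
      hHatCanOf A hA e x

end Metrics

/-- `X` is projective: it carries a very ample line bundle, that is, it has an embedding into a
projective space. -/
def IsProjective (n : ℕ) (X : Type u) [TopologicalSpace X] [ChartedSpace (Fin n → ℂ) X] : Prop :=
  ∃ L : HolLineBundle n X, L.IsVeryAmple

/-- `X` has nonnegative Kodaira dimension: `m K_X` has a nonzero section for some `m ≥ 1`. -/
def HasNonnegKodairaDim (n : ℕ) (X : Type u) [TopologicalSpace X] [ChartedSpace (Fin n → ℂ) X]
    [IsManifold 𝓘(ℂ, Fin n → ℂ) ω X] : Prop :=
  ∃ m : ℕ, 1 ≤ m ∧ ∃ σ : ((canonicalBundle n X).pow m).HolSection,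
    ∃ (e : atlas (Fin n → ℂ) X) (x : X), x ∈ e.1.source ∧ σ.val e x ≠ 0

end CanonicalAZD

end

open CanonicalAZD

/-! Fix a section `τ` of `A` and multiply: if `σ` is a section of `m K_X` with integral 1, then `τσ`
is a section of `A + m K_X` with density `|τ|^(2/m) |σ|^(2/m)`, where `|τ|` is the `h_A`-length. By
compactness `|τ|² ≤ M`, so the integral of this density is at most `M^(1/m)`. Normalizing `τσ` shows
that the twisted extremal form is at least `(|τ(x)|²/M)^(1/m)` times the untwisted one
(`rpow_mul_extremal_le`). If `τ(x) ≠ 0`, the factor tends to 1 as `m → ∞` and disappears in the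
limsup (`limsup_extremal_le`). Inverting and taking lower envelopes gives `hHatCanOf_le_hCan` for
every `A` whose sections have no common zero.

For sufficiently ample `A`, such sections come from interpolation with the trivial bundle as `L`.
For the supercanonical metric, one admissible competitor in the infimum is enough: a very ample
bundle, given by projectivity, with its Fubini–Study metric. Its curvature is strictly positive by
the equality case of Cauchy–Schwarz (`levi_log_sum_norm_sq_pos`). -/

noncomputable section

universe u

namespace CanonicalAZD

/-! ### Operations on sections, and their lengths -/

namespace HolLineBundle

variable {n : ℕ} {X : Type u} [TopologicalSpace X] [ChartedSpace (Fin n → ℂ) X]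

/-- The trivial line bundle. -/
def trivial (n : ℕ) (X : Type u) [TopologicalSpace X] [ChartedSpace (Fin n → ℂ) X] :
    HolLineBundle n X where
  ι := PUnit
  dom _ := Set.univ
  isOpen_dom _ := isOpen_univ
  indexAt _ := PUnit.unit
  mem_indexAt _ := Set.mem_univ _
  trans _ _ _ := 1
  holo_trans _ _ := contMDiffOn_const
  trans_self _ _ _ := rfl
  trans_mul _ _ _ _ _ _ _ := one_mul 1

/-- The constant metric on the trivial line bundle. -/
def trivialMetric [Nonempty X] : (trivial n X).PsefMetric where
  val _ _ := 1
  compat _ _ _ _ _ := by simp [trivial]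
  psh i e _ := by
    have h0 : (fun z : Fin n → ℂ => -ENNReal.log ((fun _ _ => 1 : PUnit.{u+1} → X → ℝ≥0∞) i
        (e.symm z))) = fun _ => (0 : EReal) := by
      funext z; simp
    refine ⟨?_, fun z _ => by simp, fun z v _ C hC => ?_⟩
    · rw [h0]; exact upperSemicontinuousOn_const
    -- The weight is 0, so the bound at a single angle gives `0 ≤ C`, and the truncation `toENNReal`
    -- loses nothing.
    · have hC0 : (0 : ℝ) ≤ C := by simpa using hC 0
      have hpi : ENNReal.ofReal (2 * Real.pi) ≠ 0 := by
        simp [Real.pi_pos]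
      simp only [ENNReal.log_one, neg_zero, sub_zero, lintegral_const, Measure.restrict_apply
        MeasurableSet.univ, Set.univ_inter, Real.volume_Ioc]
      rw [mul_div_assoc, ENNReal.div_self hpi ENNReal.ofReal_ne_top, mul_one,
        EReal.coe_toENNReal (by exact_mod_cast hC0)]
  nontrivial := ⟨PUnit.unit, Classical.arbitrary X, Set.mem_univ _, ENNReal.one_ne_top⟩

/-- A section of `A + O` as a section of `A`. -/
def HolSection.ofTensorTrivial {A : HolLineBundle n X} (σ : (A.tensor (trivial n X)).HolSection) :
    A.HolSection where
  val i := σ.val (i, PUnit.unit)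
  holo i := (σ.holo (i, PUnit.unit)).mono fun _ hx => ⟨hx, Set.mem_univ _⟩
  compat i j x hi hj := by
    have := σ.compat (i, PUnit.unit) (j, PUnit.unit) x ⟨hi, Set.mem_univ _⟩ ⟨hj, Set.mem_univ _⟩
    simpa [tensor, trivial] using this

/-- The tensor product of two sections. -/
def HolSection.tensor {A B : HolLineBundle n X} (τ : A.HolSection) (σ : B.HolSection) :
    (A.tensor B).HolSection where
  val i x := τ.val i.1 x * σ.val i.2 x
  holo i := ((τ.holo i.1).mono fun _ hx => hx.1).mul ((σ.holo i.2).mono fun _ hx => hx.2)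
  compat i j x hi hj := by
    rw [τ.compat i.1 j.1 x hi.1 hj.1, σ.compat i.2 j.2 x hi.2 hj.2]
    simp only [HolLineBundle.tensor]
    ring

/-- A section multiplied by a complex number. -/
def HolSection.smul {L : HolLineBundle n X} (c : ℂ) (σ : L.HolSection) : L.HolSection where
  val i x := c * σ.val i x
  holo i := contMDiffOn_const.mul (σ.holo i)
  compat i j x hi hj := by rw [σ.compat i j x hi hj]; ring

/-- The squared length of a section of a line bundle with a smooth hermitian metric. -/
def SmoothMetric.normSq {A : HolLineBundle n X} (hA : A.SmoothMetric) (τ : A.HolSection)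
    (x : X) : ℝ :=
  hA.val (A.indexAt x) x * ‖τ.val (A.indexAt x) x‖ ^ 2

theorem SmoothMetric.normSq_eq {A : HolLineBundle n X} (hA : A.SmoothMetric) (τ : A.HolSection)
    {i : A.ι} {x : X} (hi : x ∈ A.dom i) :
    hA.normSq τ x = hA.val i x * ‖τ.val i x‖ ^ 2 := by
  have hx := A.mem_indexAt x
  rw [normSq, τ.compat i _ x hi hx, hA.compat i _ x hi hx, norm_mul]
  ring

/-- The frame chosen by `indexAt` may jump from point to point; near `x` the fixed frame at `x`
computes the same function. -/
theorem SmoothMetric.continuous_normSq {A : HolLineBundle n X} (hA : A.SmoothMetric)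
    (τ : A.HolSection) : Continuous (hA.normSq τ) := by
  refine continuous_iff_continuousAt.2 fun x => ?_
  have hn : A.dom (A.indexAt x) ∈ 𝓝 x := (A.isOpen_dom _).mem_nhds (A.mem_indexAt x)
  have h1 : ContinuousAt (hA.val (A.indexAt x)) x :=
    (hA.smooth _).continuousOn.continuousAt hn
  have h2 : ContinuousAt (τ.val (A.indexAt x)) x := (τ.holo _).continuousOn.continuousAt hn
  refine (h1.mul (h2.norm.pow 2)).congr ?_
  filter_upwards [hn] with y hy
  exact (hA.normSq_eq τ hy).symm

theorem SmoothMetric.normSq_pos {A : HolLineBundle n X} (hA : A.SmoothMetric) (τ : A.HolSection)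
    {x : X} (h : τ.val (A.indexAt x) x ≠ 0) : 0 < hA.normSq τ x :=
  mul_pos (hA.pos _ _ (A.mem_indexAt x)) (pow_pos (norm_pos_iff.2 h) 2)

end HolLineBundle

/-! ### Integration of densities over `X` -/

section Integration

variable {n : ℕ} {X : Type u} [TopologicalSpace X] [MeasurableSpace X] [BorelSpace X]

/-- Nothing is known about `e.symm` off `e.target`, hence only a.e. measurability for the restricted
measure. -/
theorem aemeasurable_symm (e : OpenPartialHomeomorph X (Fin n → ℂ)) :
    AEMeasurable e.symm ((2 : ℝ≥0∞) ^ n • (volume : Measure (Fin n → ℂ)).restrict e.target) :=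
  (e.continuousOn_symm.aemeasurable e.open_target.measurableSet).smul_measure _

theorem ae_mem_source_chartVolume (e : OpenPartialHomeomorph X (Fin n → ℂ)) :
    ∀ᵐ x ∂chartVolume e, x ∈ e.source := by
  refine (ae_map_iff (aemeasurable_symm e) e.open_source.measurableSet).2 ?_
  refine Measure.ae_smul_measure ?_ _
  filter_upwards [ae_restrict_mem e.open_target.measurableSet] with z hz
  exact e.map_target hz

theorem chartVolume_pos (e : OpenPartialHomeomorph X (Fin n → ℂ)) {x : X} (hx : x ∈ e.source)
    {V : Set X} (hV : IsOpen V) (hxV : x ∈ V) : 0 < chartVolume e V := by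
  rw [chartVolume, Measure.map_apply_of_aemeasurable (aemeasurable_symm e) hV.measurableSet,
    Measure.smul_apply, Measure.restrict_apply' e.open_target.measurableSet, smul_eq_mul]
  have hne : (e.symm ⁻¹' V ∩ e.target).Nonempty :=
    ⟨e x, by simpa [e.left_inv hx] using hxV, e.map_source hx⟩
  have hopen : IsOpen (e.symm ⁻¹' V ∩ e.target) := by
    rw [Set.inter_comm]
    exact e.isOpen_inter_preimage_symm hV
  exact ENNReal.mul_pos (by simp) (hopen.measure_pos _ hne).ne'

variable [ChartedSpace (Fin n → ℂ) X]

/-- The integral is a supremum of measures over the charts, so densities can be compared chart by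
chart, without gluing. -/
theorem integralForm_le_mul {ρ ρ' : atlas (Fin n → ℂ) X → X → ℝ≥0∞} {c : ℝ≥0∞} (hc : c ≠ ⊤)
    (h : ∀ e, ∀ x ∈ e.1.source, ρ' e x ≤ c * ρ e x) :
    integralForm ρ' ≤ c * integralForm ρ := by
  rw [integralForm, integralForm, ← smul_eq_mul, ← Measure.smul_apply]
  refine Measure.le_iff'.1 (iSup_le fun e => ?_) _
  calc (chartVolume e.1).withDensity (ρ' e)
      ≤ (chartVolume e.1).withDensity (c • ρ e) := by
        refine withDensity_mono ?_
        filter_upwards [ae_mem_source_chartVolume e.1] with x hx using h e x hx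
    -- Finiteness of `c` replaces measurability of `ρ e`.
    _ = c • (chartVolume e.1).withDensity (ρ e) := withDensity_smul' _ _ hc
    _ ≤ _ := by
      gcongr
      exact le_iSup (fun e : atlas (Fin n → ℂ) X => (chartVolume e.1).withDensity (ρ e)) e

theorem integralForm_eq_mul {ρ ρ' : atlas (Fin n → ℂ) X → X → ℝ≥0∞} {c : ℝ≥0∞} (hc : c ≠ ⊤)
    (hc0 : c ≠ 0) (h : ∀ e, ∀ x ∈ e.1.source, ρ' e x = c * ρ e x) :
    integralForm ρ' = c * integralForm ρ := by
  refine le_antisymm (integralForm_le_mul hc fun e x hx => (h e x hx).le) ?_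
  rw [ENNReal.mul_le_iff_le_inv hc0 hc]
  refine integralForm_le_mul (ENNReal.inv_ne_top.2 hc0) fun e x hx => ?_
  rw [h e x hx, ← mul_assoc, ENNReal.inv_mul_cancel hc0 hc, one_mul]

theorem integralForm_pos {ρ : atlas (Fin n → ℂ) X → X → ℝ≥0∞} {e : atlas (Fin n → ℂ) X} {x : X}
    (hx : x ∈ e.1.source) {δ : ℝ≥0∞} (hδ : δ ≠ 0) (h : ∀ᶠ y in 𝓝 x, δ ≤ ρ e y) :
    0 < integralForm ρ := by
  obtain ⟨V, hVρ, hV, hxV⟩ := eventually_nhds_iff.1 h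
  calc 0 < δ * chartVolume e.1 V := ENNReal.mul_pos hδ (chartVolume_pos e.1 hx hV hxV).ne'
    _ = ∫⁻ _ in V, δ ∂chartVolume e.1 := by simp
    _ ≤ ∫⁻ y in V, ρ e y ∂chartVolume e.1 := setLIntegral_mono' hV.measurableSet hVρ
    _ = (chartVolume e.1).withDensity (ρ e) V := (withDensity_apply _ hV.measurableSet).symm
    _ ≤ (chartVolume e.1).withDensity (ρ e) Set.univ := measure_mono (Set.subset_univ _)
    _ ≤ integralForm ρ :=
      (le_iSup (fun e : atlas (Fin n → ℂ) X => (chartVolume e.1).withDensity (ρ e)) e) _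

end Integration

/-! ### Comparison of the extremal forms and of the metrics -/

section Comparison

variable {n : ℕ} {X : Type u} [TopologicalSpace X] [ChartedSpace (Fin n → ℂ) X]
  [IsManifold 𝓘(ℂ, Fin n → ℂ) ω X]

theorem twistedDensity_tensor {A : HolLineBundle n X} (hA : A.SmoothMetric) (m : ℕ)
    (τ : A.HolSection) (σ : ((canonicalBundle n X).pow m).HolSection)
    (e : atlas (Fin n → ℂ) X) (x : X) :
    twistedDensity A hA m (τ.tensor σ) e x =
      ENNReal.ofReal (hA.normSq τ x) ^ (1 / (m : ℝ)) * pluriDensity m σ e x := by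
  have h2 : (2 / (m : ℝ)) = 2 * (1 / (m : ℝ)) := by ring
  have hm : (0 : ℝ) ≤ 1 / (m : ℝ) := by positivity
  have hp := (hA.pos _ _ (A.mem_indexAt x)).le
  simp only [twistedDensity, HolLineBundle.HolSection.tensor, pluriDensity,
    HolLineBundle.SmoothMetric.normSq]
  rw [enorm_mul, ENNReal.mul_rpow_of_nonneg _ _ (by positivity), ENNReal.ofReal_mul hp,
    ENNReal.mul_rpow_of_nonneg _ _ hm, ENNReal.ofReal_pow (norm_nonneg _), ofReal_norm,
    ← ENNReal.rpow_natCast, ← ENNReal.rpow_mul, Nat.cast_ofNat, ← h2, mul_assoc]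

theorem twistedDensity_smul {A : HolLineBundle n X} (hA : A.SmoothMetric) (m : ℕ)
    (c : ℂ) (σ : (twist A m).HolSection) (e : atlas (Fin n → ℂ) X) (x : X) :
    twistedDensity A hA m (σ.smul c) e x =
      ‖c‖ₑ ^ (2 / (m : ℝ)) * twistedDensity A hA m σ e x := by
  simp only [twistedDensity, HolLineBundle.HolSection.smul]
  rw [enorm_mul, ENNReal.mul_rpow_of_nonneg _ _ (by positivity)]
  ring

/-- Scaling a section by `c` scales its density by this power of `|c|`, so any section with finite
nonzero integral can be normalized. For `m = 0` the exponent would be 0. -/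
theorem exists_enorm_rpow_eq {m : ℕ} (hm : m ≠ 0) {a : ℝ≥0∞} (ha : a ≠ ⊤) :
    ∃ c : ℂ, ‖c‖ₑ ^ (2 / (m : ℝ)) = a := by
  have hm' : (m : ℝ) ≠ 0 := by exact_mod_cast hm
  refine ⟨((a ^ ((m : ℝ) / 2)).toReal : ℂ), ?_⟩
  have h : ‖((a ^ ((m : ℝ) / 2)).toReal : ℂ)‖ₑ = a ^ ((m : ℝ) / 2) := by
    rw [← ofReal_norm, Complex.norm_real, Real.norm_of_nonneg ENNReal.toReal_nonneg,
      ENNReal.ofReal_toReal (ENNReal.rpow_ne_top_of_nonneg (by positivity) ha)]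
  rw [h, ← ENNReal.rpow_mul, show (m : ℝ) / 2 * (2 / m) = 1 by field_simp, ENNReal.rpow_one]

variable [MeasurableSpace X]

/-- For the trivial bundle with constant metric every vector has finite length, so the value 1 at
`x` can be interpolated. -/
theorem exists_section_ne_zero_of_hasInterpolation {A : HolLineBundle n X} {hA : A.SmoothMetric}
    (h : HasInterpolation A hA) (x : X) : ∃ τ : A.HolSection, τ.val (A.indexAt x) x ≠ 0 := by
  have : Nonempty X := ⟨x⟩
  obtain ⟨w, C, hC⟩ := h
  obtain ⟨σ, -, hσ, -⟩ := hC (HolLineBundle.trivial n X) HolLineBundle.trivialMetric x 1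
    (by simp [HolLineBundle.trivialMetric])
  refine ⟨HolLineBundle.HolSection.ofTensorTrivial σ, ?_⟩
  have : σ.val (A.indexAt x, PUnit.unit) x = 1 := hσ
  simp [HolLineBundle.HolSection.ofTensorTrivial, this]

theorem hHatCan_le_hHatCanOf {A : HolLineBundle n X} (hample : A.IsAmple) (hA : A.SmoothMetric)
    (hpos : hA.HasPositiveCurvature) :
    MetricLE (hHatCan (n := n) (X := X)) (hHatCanOf A hA) := by
  intro e x _
  have h : hHatCan e x ≤ ⨅ (A : HolLineBundle n X) (_ : A.IsAmple) (hA : A.SmoothMetric)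
      (_ : hA.HasPositiveCurvature), hHatCanOf A hA e x :=
    -- `x` lies in each of its neighbourhoods, so the envelope is at most the value at `x`.
    liminf_le_of_frequently_le' fun h => h.self_of_nhds le_rfl
  exact h.trans (iInf_le_of_le A (iInf_le_of_le hample (iInf_le_of_le hA (iInf_le _ hpos))))

variable [BorelSpace X]

/-- The twisted density of a section at `x`, divided by the integral, bounds the extremal form. -/
theorem inv_integralForm_mul_le_extremalTwisted {A : HolLineBundle n X} (hA : A.SmoothMetric)
    {m : ℕ} (hm : m ≠ 0) (σ : (twist A m).HolSection)
    (h0 : integralForm (twistedDensity A hA m σ) ≠ 0)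
    (htop : integralForm (twistedDensity A hA m σ) ≠ ⊤) (e : atlas (Fin n → ℂ) X) (x : X) :
    (integralForm (twistedDensity A hA m σ))⁻¹ * twistedDensity A hA m σ e x ≤
      extremalTwisted A hA m e x := by
  obtain ⟨c, hc⟩ := exists_enorm_rpow_eq hm (ENNReal.inv_ne_top.2 h0)
  rw [← hc, ← twistedDensity_smul]
  refine le_iSup₂_of_le (σ.smul c) ?_ le_rfl
  rw [integralForm_eq_mul (ENNReal.inv_ne_top.2 h0) (ENNReal.inv_ne_zero.2 htop)
    (fun e x _ => by rw [twistedDensity_smul, hc]), ENNReal.inv_mul_cancel h0 htop]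

/-- Both factors of the density are continuous and positive at `x`, hence bounded below nearby. This
permits division by the integral. -/
theorem integralForm_tensor_pos {A : HolLineBundle n X} (hA : A.SmoothMetric) (m : ℕ)
    (τ : A.HolSection) (σ : ((canonicalBundle n X).pow m).HolSection)
    {e : atlas (Fin n → ℂ) X} {x : X} (hx : x ∈ e.1.source) (hτ : τ.val (A.indexAt x) x ≠ 0)
    (hσ : pluriDensity m σ e x ≠ 0) :
    0 < integralForm (twistedDensity A hA m (τ.tensor σ)) := by
  have hcτ : ContinuousAt (fun y => ENNReal.ofReal (hA.normSq τ y) ^ (1 / (m : ℝ))) x :=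
    (ENNReal.continuous_rpow_const.comp
      (ENNReal.continuous_ofReal.comp (hA.continuous_normSq τ))).continuousAt
  have hcσ : ContinuousAt (pluriDensity m σ e) x := by
    have : ContinuousAt (σ.val e) x :=
      (σ.holo e).continuousOn.continuousAt (e.1.open_source.mem_nhds hx)
    exact ENNReal.continuous_rpow_const.continuousAt.comp this.enorm
  have hτ0 : 0 < ENNReal.ofReal (hA.normSq τ x) ^ (1 / (m : ℝ)) :=
    ENNReal.rpow_pos (by simpa using hA.normSq_pos τ hτ) ENNReal.ofReal_ne_top
  obtain ⟨a, ha0, ha⟩ := exists_between hτ0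
  obtain ⟨b, hb0, hb⟩ := exists_between (pos_iff_ne_zero.2 hσ)
  refine integralForm_pos hx (mul_ne_zero ha0.ne' hb0.ne') ?_
  filter_upwards [hcτ.eventually_const_lt ha, hcσ.eventually_const_lt hb] with y h1 h2
  rw [twistedDensity_tensor]
  exact mul_le_mul' h1.le h2.le

theorem rpow_mul_extremal_le {A : HolLineBundle n X} (hA : A.SmoothMetric) (τ : A.HolSection)
    {M : ℝ} (hM : ∀ y, hA.normSq τ y ≤ M) {m : ℕ} (hm : m ≠ 0) {e : atlas (Fin n → ℂ) X} {x : X}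
    (hx : x ∈ e.1.source) (hτ : τ.val (A.indexAt x) x ≠ 0) :
    (ENNReal.ofReal (hA.normSq τ x) / ENNReal.ofReal M) ^ (1 / (m : ℝ)) * extremal m e x ≤
      extremalTwisted A hA m e x := by
  have hm0 : (0 : ℝ) ≤ 1 / (m : ℝ) := by positivity
  rw [extremal, ENNReal.mul_iSup]
  refine iSup_le fun σ => ?_
  rw [ENNReal.mul_iSup]
  refine iSup_le fun hσ => ?_
  -- If `σ` contributes 0 at `x` there is nothing to prove; otherwise the integral of `τσ` is
  -- positive.
  by_cases hσx : pluriDensity m σ e x = 0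
  · simp [hσx]
  have hMtop : ENNReal.ofReal M ^ (1 / (m : ℝ)) ≠ ⊤ :=
    ENNReal.rpow_ne_top_of_nonneg hm0 ENNReal.ofReal_ne_top
  have hI : integralForm (twistedDensity A hA m (τ.tensor σ)) ≤
      ENNReal.ofReal M ^ (1 / (m : ℝ)) := by
    -- The factor 1 is the integral of `|σ|^(2/m)`, which turns the claim into a comparison of
    -- densities.
    rw [← mul_one (ENNReal.ofReal M ^ (1 / (m : ℝ))), ← hσ]
    refine integralForm_le_mul hMtop fun e y _ => ?_
    rw [twistedDensity_tensor]
    gcongr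
    exact hM y
  refine le_trans ?_ (inv_integralForm_mul_le_extremalTwisted hA hm (τ.tensor σ)
    (integralForm_tensor_pos hA m τ σ hx hτ hσx).ne' (ne_top_of_le_ne_top hMtop hI) e x)
  rw [twistedDensity_tensor, ENNReal.div_rpow_of_nonneg _ _ hm0, div_eq_mul_inv,
    mul_comm (_ ^ _) (_ ^ _)⁻¹, mul_assoc]
  gcongr

theorem limsup_extremal_le [CompactSpace X] {A : HolLineBundle n X} (hA : A.SmoothMetric)
    (τ : A.HolSection) {e : atlas (Fin n → ℂ) X} {x : X} (hx : x ∈ e.1.source)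
    (hτ : τ.val (A.indexAt x) x ≠ 0) :
    limsup (fun m : ℕ => extremal m e x) atTop ≤
      limsup (fun m : ℕ => extremalTwisted A hA m e x) atTop := by
  obtain ⟨M, hM⟩ := (isCompact_range (hA.continuous_normSq τ)).bddAbove
  have hM' : ∀ y, hA.normSq τ y ≤ M := fun y => hM ⟨y, rfl⟩
  have hpos := hA.normSq_pos τ hτ
  set c : ℝ≥0∞ := ENNReal.ofReal (hA.normSq τ x) / ENNReal.ofReal M
  have hc0 : c ≠ 0 := (ENNReal.div_pos (by simpa using hpos) ENNReal.ofReal_ne_top).ne'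
  have hctop : c ≠ ⊤ :=
    ENNReal.div_ne_top ENNReal.ofReal_ne_top (by simpa using hpos.trans_le (hM' x))
  have hlim : Tendsto (fun m : ℕ => c ^ (1 / (m : ℝ))) atTop (𝓝 1) := by
    -- `c` is nonzero and finite, so `(c, s) ↦ c ^ s` is continuous at `(c, 0)` in `NNReal`.
    clear_value c
    lift c to NNReal using hctop
    have h : Tendsto (fun m : ℕ => c ^ (1 / (m : ℝ))) atTop (𝓝 (c ^ (0 : ℝ))) :=
      (NNReal.continuousAt_rpow (Or.inl (by exact_mod_cast hc0))).tendsto.comp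
        (tendsto_const_nhds.prodMk_nhds tendsto_one_div_atTop_nhds_zero_nat)
    rw [NNReal.rpow_zero] at h
    have h' := ENNReal.tendsto_coe.2 h
    refine h'.congr fun m => ?_
    exact ENNReal.coe_rpow_of_nonneg _ (by positivity : (0 : ℝ) ≤ 1 / (m : ℝ))
  -- Any constant `a < 1` is eventually below `c ^ (1/m)`, so the factor depending on `m` can be
  -- replaced by a constant that leaves the limsup.
  refine ENNReal.le_of_forall_lt_one_mul_le fun a ha => ?_
  rw [← ENNReal.limsup_const_mul_of_ne_top (ne_top_of_lt ha)]
  refine limsup_le_limsup ?_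
  filter_upwards [hlim.eventually_const_lt ha, eventually_ne_atTop 0] with m h1 h2
  exact (mul_le_mul_left h1.le _).trans (rpow_mul_extremal_le hA τ hM' h2 hx hτ)

/-- If the sections of `A` have no common zeros, then `ĥ_{can,A} ≤ h_can`. -/
theorem hHatCanOf_le_hCan [CompactSpace X] {A : HolLineBundle n X} (hA : A.SmoothMetric)
    (hgen : ∀ x, ∃ τ : A.HolSection, τ.val (A.indexAt x) x ≠ 0) :
    MetricLE (hHatCanOf A hA) (hCan (n := n) (X := X)) := by
  intro e x hx
  refine liminf_le_liminf ?_
  filter_upwards [e.1.open_source.mem_nhds hx] with y hy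
  -- `τ` may change with `y`: the limsup inequality has no constant left, so no uniformity is
  -- needed.
  obtain ⟨τ, hτ⟩ := hgen y
  exact ENNReal.inv_le_inv.2 (limsup_extremal_le hA τ hy hτ)

end Comparison

/-! ### The Levi form of `log ∑ |f_k|²` -/

section LeviForm

variable {E : Type*} [NormedAddCommGroup E] [NormedSpace ℂ E] [NormedSpace ℝ E]
  [IsScalarTower ℝ ℂ E] {ι : Type*} [Fintype ι]

theorem hasFDerivAt_log_sum_norm_sq {f : ι → E → ℂ} {z : E} (hf : ∀ k, DifferentiableAt ℂ (f k) z)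
    (h0 : ∑ k, ‖f k z‖ ^ 2 ≠ 0) :
    HasFDerivAt (fun z => Real.log (∑ k, ‖f k z‖ ^ 2))
      ((∑ k, ‖f k z‖ ^ 2)⁻¹ • ∑ k, 2 • (innerSL ℝ (f k z)).comp
        ((fderiv ℂ (f k) z).restrictScalars ℝ)) z := by
  refine HasFDerivAt.log ?_ h0
  exact HasFDerivAt.fun_sum fun k _ => ((hf k).hasFDerivAt.restrictScalars ℝ).norm_sq

/-- The second derivative of `log ∑ |f_k|²` in the direction `w`. -/
theorem fderiv_fderiv_log_sum_norm_sq {f : ι → E → ℂ} {z : E}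
    (hf : ∀ k, ContDiffAt ℂ ω (f k) z) (h0 : ∑ k, ‖f k z‖ ^ 2 ≠ 0) (w : E) :
    fderiv ℝ (fderiv ℝ fun z => Real.log (∑ k, ‖f k z‖ ^ 2)) z w w =
      ((∑ k, 2 * (inner ℝ (f k z) (fderiv ℂ (fderiv ℂ (f k)) z w w) +
          inner ℝ (fderiv ℂ (f k) z w) (fderiv ℂ (f k) z w))) * (∑ k, ‖f k z‖ ^ 2) -
        (∑ k, 2 * inner ℝ (f k z) (fderiv ℂ (f k) z w)) *
          (∑ k, 2 * inner ℝ (f k z) (fderiv ℂ (f k) z w))) / (∑ k, ‖f k z‖ ^ 2) ^ 2 := by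
  set φ : E → ℝ := fun z => Real.log (∑ k, ‖f k z‖ ^ 2) with hφ
  have hdiff : ∀ k, DifferentiableAt ℂ (f k) z := fun k => (hf k).differentiableAt (by simp)
  have hfR : ∀ k, ContDiffAt ℝ ω (f k) z := fun k => (hf k).restrict_scalars ℝ
  have hφc : ContDiffAt ℝ ω φ z :=
    ContDiffAt.log (ContDiffAt.sum fun k _ => (hfR k).norm_sq ℝ) h0
  have hφ' : DifferentiableAt ℝ (fderiv ℝ φ) z :=
    (hφc.fderiv_right (m := ω) le_rfl).differentiableAt (by simp)
  -- Along the real line `z + t w` the second derivative becomes a one-variable derivative, computed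
  -- by the quotient rule.
  have hline : HasDerivAt (fun t : ℝ => fderiv ℝ φ (z + t • w) w)
      (fderiv ℝ (fderiv ℝ φ) z w w) 0 :=
    HasFDerivAt.hasLineDerivAt (f := fun y => fderiv ℝ φ y w)
      (hφ'.hasFDerivAt.clm_apply (hasFDerivAt_const w z)) w |>.congr_deriv (by simp)
  have hp : ∀ k, HasDerivAt (fun t : ℝ => f k (z + t • w)) (fderiv ℂ (f k) z w) 0 := fun k =>
    ((hdiff k).hasFDerivAt.restrictScalars ℝ).hasLineDerivAt w
  have hq : ∀ k, HasDerivAt (fun t : ℝ => fderiv ℂ (f k) (z + t • w) w)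
      (fderiv ℂ (fderiv ℂ (f k)) z w w) 0 := fun k => by
    have hd : DifferentiableAt ℂ (fderiv ℂ (f k)) z :=
      ((hf k).fderiv_right (m := ω) le_rfl).differentiableAt (by simp)
    have h := (hd.hasFDerivAt.clm_apply (hasFDerivAt_const w z)).restrictScalars ℝ
    exact (h.hasLineDerivAt w).congr_deriv (by simp)
  have hF : HasDerivAt (fun t : ℝ => ∑ k, ‖f k (z + t • w)‖ ^ 2)
      (∑ k, 2 * inner ℝ (f k z) (fderiv ℂ (f k) z w)) 0 :=
    HasDerivAt.fun_sum fun k _ => by simpa using (hp k).norm_sq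
  have hN : HasDerivAt (fun t : ℝ => ∑ k, 2 * inner ℝ (f k (z + t • w))
        (fderiv ℂ (f k) (z + t • w) w))
      (∑ k, 2 * (inner ℝ (f k z) (fderiv ℂ (fderiv ℂ (f k)) z w w) +
          inner ℝ (fderiv ℂ (f k) z w) (fderiv ℂ (f k) z w))) 0 :=
    HasDerivAt.fun_sum fun k _ => by
      simpa using ((hp k).inner ℝ (hq k)).const_mul (2 : ℝ)
  have hquot := hN.fun_div hF (by simpa using h0)
  -- The first-derivative formula may be differentiated because it holds near `t = 0`: regularity of
  -- the `f_k` and nonvanishing of the sum are open conditions.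
  have hev : (fun t : ℝ => fderiv ℝ φ (z + t • w) w) =ᶠ[𝓝 0] fun t : ℝ =>
      (∑ k, 2 * inner ℝ (f k (z + t • w)) (fderiv ℂ (f k) (z + t • w) w)) /
        ∑ k, ‖f k (z + t • w)‖ ^ 2 := by
    have hc : Tendsto (fun t : ℝ => z + t • w) (𝓝 0) (𝓝 z) := by
      have : Continuous fun t : ℝ => z + t • w := by fun_prop
      simpa using this.tendsto 0
    have h1 : ∀ᶠ y in 𝓝 z, ∀ k, DifferentiableAt ℂ (f k) y :=
      eventually_all.2 fun k => (((hf k).of_le (m := 1) (by simp)).eventually (by simp)).mono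
        fun y hy => hy.differentiableAt (by simp)
    have h2 : ∀ᶠ y in 𝓝 z, ∑ k, ‖f k y‖ ^ 2 ≠ 0 := by
      have : ContinuousAt (fun y => ∑ k, ‖f k y‖ ^ 2) z :=
        tendsto_finsetSum _ fun k _ => (hdiff k).continuousAt.norm.pow 2
      exact this.eventually_ne h0
    filter_upwards [hc.eventually h1, hc.eventually h2] with t ht1 ht2
    rw [hφ, (hasFDerivAt_log_sum_norm_sq ht1 ht2).fderiv]
    simp [div_eq_inv_mul, mul_add]
  rw [hline.unique (hquot.congr_of_eventuallyEq hev)]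
  simp

/-- Equality in Cauchy–Schwarz would make `a` a multiple of `f`. The case `c = 0` of `ha` gives `a ≠
0`. -/
theorem norm_sum_conj_mul_sq_lt {f a : ι → ℂ} (hf : ∃ k, f k ≠ 0)
    (ha : ∀ c : ℂ, ∃ k, a k ≠ c * f k) :
    ‖∑ k, starRingEnd ℂ (f k) * a k‖ ^ 2 < (∑ k, ‖a k‖ ^ 2) * ∑ k, ‖f k‖ ^ 2 := by
  set x : EuclideanSpace ℂ ι := WithLp.toLp 2 f
  set y : EuclideanSpace ℂ ι := WithLp.toLp 2 a
  have hx : x ≠ 0 := fun h => by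
    obtain ⟨k, hk⟩ := hf
    exact hk (congrArg (fun v : EuclideanSpace ℂ ι => v k) h)
  have hy : y ≠ 0 := fun h => by
    obtain ⟨k, hk⟩ := ha 0
    exact hk (by simpa using congrArg (fun v : EuclideanSpace ℂ ι => v k) h)
  have hin : (∑ k, starRingEnd ℂ (f k) * a k) = inner ℂ x y := by
    simp [x, y, PiLp.inner_apply, mul_comm]
  have hlt : ‖inner ℂ x y‖ < ‖x‖ * ‖y‖ := by
    refine lt_of_le_of_ne (norm_inner_le_norm x y) fun h => ?_
    obtain ⟨r, -, hr⟩ := (norm_inner_eq_norm_iff hx hy).1 h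
    obtain ⟨k, hk⟩ := ha r
    exact hk (congrArg (fun v : EuclideanSpace ℂ ι => v k) hr)
  have hxx : ∑ k, ‖f k‖ ^ 2 = ‖x‖ ^ 2 := by simp [x, EuclideanSpace.norm_sq_eq]
  have hyy : ∑ k, ‖a k‖ ^ 2 = ‖y‖ ^ 2 := by simp [y, EuclideanSpace.norm_sq_eq]
  rw [hin, hxx, hyy, mul_comm, ← mul_pow]
  gcongr

/-- The Levi form of `log ∑ |f_k|²` is positive in each direction in which the derivative of
`(f_k)` is not a multiple of `(f_k)`. -/
theorem levi_log_sum_norm_sq_pos {f : ι → E → ℂ} {z : E} (hf : ∀ k, ContDiffAt ℂ ω (f k) z)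
    (h0 : ∃ k, f k z ≠ 0) {v : E} (hv : ∀ c : ℂ, ∃ k, fderiv ℂ (f k) z v ≠ c * f k z) :
    0 < iteratedFDeriv ℝ 2 (fun z => Real.log (∑ k, ‖f k z‖ ^ 2)) z ![v, v] +
      iteratedFDeriv ℝ 2 (fun z => Real.log (∑ k, ‖f k z‖ ^ 2)) z
        ![Complex.I • v, Complex.I • v] := by
  have hpos : 0 < ∑ k, ‖f k z‖ ^ 2 := by
    obtain ⟨k, hk⟩ := h0
    exact Finset.sum_pos' (fun _ _ => by positivity) ⟨k, Finset.mem_univ _, by positivity⟩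
  have hcs := norm_sum_conj_mul_sq_lt h0 hv
  set s := ∑ k, starRingEnd ℂ (f k z) * fderiv ℂ (f k) z v with hs
  -- The directions `v` and `iv` see the real part and minus the imaginary part of the hermitian
  -- product `s`. In the sum over both directions the second derivatives of `f_k` cancel, since
  -- `D²f(iv, iv) = -D²f(v, v)`. The numerator left is `4 (∑ |df_k(v)|² ∑ |f_k|² - |s|²)`, positive
  -- by `hcs`.
  have hre : ∑ k, inner ℝ (f k z) (fderiv ℂ (f k) z v) = s.re := by
    simp [hs, Complex.inner, mul_comm]
  have him : ∑ k, inner ℝ (f k z) (Complex.I * fderiv ℂ (f k) z v) = -s.im := by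
    rw [hs, Complex.im_sum, ← Finset.sum_neg_distrib]
    refine Finset.sum_congr rfl fun k _ => ?_
    simp [Complex.inner]
    ring
  rw [Complex.sq_norm, Complex.normSq_apply] at hcs
  simp only [iteratedFDeriv_two_apply, Matrix.cons_val_zero, Matrix.cons_val_one]
  rw [fderiv_fderiv_log_sum_norm_sq hf hpos.ne', fderiv_fderiv_log_sum_norm_sq hf hpos.ne',
    ← add_div]
  refine div_pos ?_ (by positivity)
  simp only [map_smul, smul_eq_mul, smul_apply, ← mul_assoc, Complex.I_mul_I,
    neg_one_mul, inner_neg_right, ← Finset.mul_sum, Finset.sum_add_distrib,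
    Finset.sum_neg_distrib, real_inner_self_eq_norm_sq, norm_mul, Complex.norm_I, one_mul, hre, him]
  nlinarith

end LeviForm

/-! ### The Fubini–Study metric of a very ample bundle -/

section FubiniStudy

variable {n : ℕ} {X : Type u} [TopologicalSpace X] [ChartedSpace (Fin n → ℂ) X]

theorem contMDiffOn_restrictScalars {F : Type*} [NormedAddCommGroup F] [NormedSpace ℂ F]
    {f : X → F} {s : Set X} (hf : ContMDiffOn 𝓘(ℂ, Fin n → ℂ) 𝓘(ℂ, F) ω f s) :
    ContMDiffOn 𝓘(ℝ, Fin n → ℂ) 𝓘(ℝ, F) ω f s := by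
  intro x hx
  have h := contMDiffWithinAt_iff.1 (hf x hx)
  refine contMDiffWithinAt_iff.2 ⟨h.1, ?_⟩
  exact h.2.restrict_scalars ℝ

namespace HolLineBundle

/-- The Fubini–Study metric of finitely many sections without common zeros. -/
def fubiniStudy (L : HolLineBundle n X) {N : ℕ} (s : Fin N → L.HolSection)
    (hs : ∀ i x, x ∈ L.dom i → ∃ k, (s k).val i x ≠ 0) : L.SmoothMetric where
  val i x := (∑ k, ‖(s k).val i x‖ ^ 2)⁻¹
  pos i x hx := by
    obtain ⟨k, hk⟩ := hs i x hx
    exact inv_pos.2 (Finset.sum_pos' (fun _ _ => by positivity)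
      ⟨k, Finset.mem_univ _, by positivity⟩)
  smooth i x hx := by
    have hpos : ∑ k, ‖(s k).val i x‖ ^ 2 ≠ 0 := by
      obtain ⟨k, hk⟩ := hs i x hx
      exact (Finset.sum_pos' (fun _ _ => by positivity)
        ⟨k, Finset.mem_univ _, by positivity⟩).ne'
    have hφ : ContDiffAt ℝ ∞ (fun p : Fin N → ℂ => (∑ k, ‖p k‖ ^ 2)⁻¹)
        (fun k => (s k).val i x) :=
      ContDiffAt.inv (ContDiffAt.sum fun k _ => (contDiff_apply ℝ ℂ k).contDiffAt.norm_sq ℝ) hpos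
    have hsec : ContMDiffWithinAt 𝓘(ℝ, Fin n → ℂ) 𝓘(ℝ, Fin N → ℂ) ∞
        (fun y k => (s k).val i y) (L.dom i) x :=
      contMDiffWithinAt_pi_space.2 fun k =>
        (contMDiffOn_restrictScalars ((s k).holo i) x hx).of_le (by simp)
    exact ContMDiffAt.comp_contMDiffWithinAt (g := fun p : Fin N → ℂ => (∑ k, ‖p k‖ ^ 2)⁻¹) x
      hφ.contMDiffAt hsec
  compat i j x hi hj := by
    have h : ∑ k, ‖(s k).val i x‖ ^ 2 = ‖L.trans i j x‖ ^ 2 * ∑ k, ‖(s k).val j x‖ ^ 2 := by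
      rw [Finset.mul_sum]
      refine Finset.sum_congr rfl fun k _ => ?_
      rw [(s k).compat i j x hi hj, norm_mul, mul_pow]
    -- The cocycle identity makes `trans j i x` an inverse of `trans i j x`.
    have ht : ‖L.trans i j x‖ ^ 2 ≠ 0 := by
      have h1 := L.trans_mul i j i x hi hj hi
      rw [L.trans_self i x hi] at h1
      exact pow_ne_zero 2 (norm_ne_zero_iff.2 (left_ne_zero_of_mul_eq_one h1))
    rw [h, mul_inv, mul_inv_cancel_left₀ ht]

theorem IsVeryAmple.isAmple {L : HolLineBundle n X} (h : L.IsVeryAmple) : L.IsAmple := by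
  obtain ⟨N, s, h1, h2, h3⟩ := h
  refine ⟨1, le_rfl, N, fun k => ⟨(s k).val, (s k).holo, fun i j x hi hj => ?_⟩, h1, h2, h3⟩
  simpa [pow] using (s k).compat i j x hi hj

variable [IsManifold 𝓘(ℂ, Fin n → ℂ) ω X]

theorem HolSection.contDiffAt_comp_symm {L : HolLineBundle n X} (s : L.HolSection) {i : L.ι}
    {e : OpenPartialHomeomorph X (Fin n → ℂ)} (he : e ∈ atlas (Fin n → ℂ) X) {x : X}
    (hi : x ∈ L.dom i) (hx : x ∈ e.source) : ContDiffAt ℂ ω (s.val i ∘ e.symm) (e x) := by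
  have h1 : ContMDiffAt 𝓘(ℂ, Fin n → ℂ) 𝓘(ℂ, Fin n → ℂ) ω e.symm (e x) :=
    contMDiffAt_symm_of_mem_maximalAtlas (IsManifold.subset_maximalAtlas he) (e.map_source hx)
  have h2 : ContMDiffAt 𝓘(ℂ, Fin n → ℂ) 𝓘(ℂ, ℂ) ω (s.val i) (e.symm (e x)) := by
    rw [e.left_inv hx]
    exact (s.holo i).contMDiffAt ((L.isOpen_dom i).mem_nhds hi)
  exact (h2.comp (e x) h1).contDiffAt

/-- The local weight is `log ∑ |s_k|²`, and the immersion condition says that for `v ≠ 0` the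
derivative of `(s_k)` along `v` is not a multiple of `(s_k)`, which is what positivity of the Levi
form requires. -/
theorem fubiniStudy_hasPositiveCurvature (L : HolLineBundle n X) {N : ℕ}
    (s : Fin N → L.HolSection) (hs : ∀ i x, x ∈ L.dom i → ∃ k, (s k).val i x ≠ 0)
    (himm : ∀ i x, x ∈ L.dom i → ∀ e ∈ atlas (Fin n → ℂ) X, x ∈ e.source → ∀ v : Fin n → ℂ,
      (∃ c : ℂ, ∀ k, fderiv ℂ ((s k).val i ∘ e.symm) (e x) v = c * (s k).val i x) → v = 0) :
    (L.fubiniStudy s hs).HasPositiveCurvature := by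
  intro i e he x hi hx v hv
  have hlog : (fun z => -Real.log ((L.fubiniStudy s hs).val i (e.symm z))) =
      fun z => Real.log (∑ k, ‖((s k).val i ∘ e.symm) z‖ ^ 2) := by
    funext z
    simp [fubiniStudy, Real.log_inv]
  rw [hlog]
  refine levi_log_sum_norm_sq_pos (fun k => (s k).contDiffAt_comp_symm he hi hx) ?_ fun c => ?_
  · simpa [e.left_inv hx] using hs i x hi
  · by_contra! hc
    exact hv (himm i x hi e he hx v ⟨c, fun k => by simpa [e.left_inv hx] using hc k⟩)

end HolLineBundle

end FubiniStudy

end CanonicalAZD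

end

theorem theorem2p9 {n : ℕ} {X : Type*} [TopologicalSpace X] [T2Space X] [CompactSpace X]
    [ConnectedSpace X] [MeasurableSpace X] [BorelSpace X] [ChartedSpace (Fin n → ℂ) X]
    [IsManifold 𝓘(ℂ, Fin n → ℂ) ω X]
    (hproj : IsProjective n X) (hkod : HasNonnegKodairaDim n X) :
    (∀ (A : HolLineBundle n X) (hA : A.SmoothMetric), hA.HasPositiveCurvature →
      IsSufficientlyAmple A hA → MetricLE (hHatCanOf A hA) (hCan (n := n) (X := X))) ∧
    MetricLE (hHatCan (n := n) (X := X)) (hCan (n := n) (X := X)) := by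
  refine ⟨fun A hA _ hsuff =>
    hHatCanOf_le_hCan hA (exists_section_ne_zero_of_hasInterpolation hsuff.2.2), ?_⟩
  -- The infimum runs over all ample bundles, so `L` need only be ample with a positively curved
  -- metric and have sections without common zeros.
  obtain ⟨L, hL⟩ := hproj
  have hample := hL.isAmple
  obtain ⟨N, s, hs, -, himm⟩ := hL
  have hgen : ∀ x, ∃ τ : L.HolSection, τ.val (L.indexAt x) x ≠ 0 := fun x =>
    (hs _ x (L.mem_indexAt x)).imp' s fun _ h => h
  intro e x hx
  exact (hHatCan_le_hHatCanOf hample (L.fubiniStudy s hs)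
    (L.fubiniStudy_hasPositiveCurvature s hs himm) e x hx).trans
      (hHatCanOf_le_hCan (L.fubiniStudy s hs) hgen e x hx)
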